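/- A path is a finite word of unit north steps $N$ and east steps $E$, starting at $(0,0)$; $|v|$ is its number of steps. For a path $v$, let $\mathrm{Tam}(v)$ be the set of paths with the same endpoints as $v$ and weakly above $v$. For an integer point $p$ weakly above $v$, $\mathrm{horiz}_v(p)$ is the maximum number of east steps that can be added to the right of $p$ without crossing $v$. If a point $p$ of $u\in\mathrm{Tam}(v)$ is preceded by an east step $E$ and followed by a north step, let $p'$ be the first point of $u$ after $p$ with $\mathrm{horiz}_v(p')=\mathrm{horiz}_v(p)$, and let $u'$ be obtained from $u$ by switching $E$ and the part of $u$ between $p$ and $p'$; set $u<_v u'$. $\mathrm{Tam}(v)$ is ordered by the reflexive transitive closure of $<_v$. The complete binary trees with $n$ interior vertices are ordered by the reflexive transitive closure of right rotation, which replaces a subtree $((A,B),C)$ by $(A,(B,C))$. The post-order traversal on edges sends such a tree to the path obtained by walking around it, starting at the root and visiting left subtrees before right subtrees, and writing $N$ (resp. $E$) each time a left (resp. right) edge is traversed for the second time. The interior canopy of a complete binary tree is the path obtained by walking in the same way around the binary tree formed by its interior vertices, writing $N$ each time a left edge is traversed for the second time and $E$ each time a right edge is traversed for the first time. For a path $v$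 with $n-1$ steps, let $I(v)$ be the set of complete binary trees with $n$ interior vertices whose interior canopy is $v$. **Theorem.** Let $n\ge 1$. The post-order traversal on edges is an order isomorphism from the complete binary trees with $n$ interior vertices onto the usual Tamari lattice $\mathrm{Tam}((NE)^n)$. Under this identification, $$\mathrm{Tam}((NE)^n)=\bigsqcup_{|v|=n-1} I(v),$$ a disjoint union over all paths $v$ with $n-1$ steps, in which every $I(v)$ is a (non-empty) interval of $\mathrm{Tam}((NE)^n)$ and, with the induced order, is isomorphic to $\mathrm{Tam}(v)$. -/

import Mathlib

namespace NuTamari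

/-- A relation along which a natural-number statistic strictly increases generates an
antisymmetric reflexive transitive closure. -/
theorem reflTransGen_antisymm {α : Type*} {r : α → α → Prop} (f : α → ℕ)
    (h : ∀ a b, r a b → f a < f b) {a b : α}
    (hab : Relation.ReflTransGen r a b) (hba : Relation.ReflTransGen r b a) : a = b := by
  have key : ∀ {x y : α}, Relation.ReflTransGen r x y → x = y ∨ f x < f y := by
    intro x y hxy
    induction hxy with
    | refl => exact Or.inl rfl
    | tail _ hbc ih =>
      rcases ih with rfl | ih
      · exact Or.inr (h _ _ hbc)
      · exact Or.inr (ih.trans (h _ _ hbc))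
  rcases key hab with h1 | h1
  · exact h1
  · rcases key hba with h2 | h2
    · exact h2.symm
    · omega

/-! ### Lattice paths and the posets `Tam v` -/

/-- A unit step: north or east. -/
inductive Step : Type
  | N : Step
  | E : Step
  deriving DecidableEq

/-- A (finite) path on the square grid, starting at `(0,0)`, as its sequence of unit steps. -/
abbrev LatticePath : Type := List Step

/-- The point `(x, y)` at which a path ends. -/
def endpoint (w : LatticePath) : ℕ × ℕ := (w.count Step.E, w.count Step.N)

/-- The abscissa of the rightmost point of `v` at height `y`, that is, the number of east steps
of `v` before its `(y+1)`-st north step (for `y` at most the height of `v`). -/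
def rowEnd : LatticePath → ℕ → ℕ
  | [], _ => 0
  | Step.E :: v, y => rowEnd v y + 1
  | Step.N :: _, 0 => 0
  | Step.N :: v, y + 1 => rowEnd v y

/-- The horizontal distance of the point `p` to the path `v`: for `p` weakly above `v`,
the maximum number of east steps that can be added to the right of `p` without crossing `v`.
It is integer valued, so that the subtraction is not truncated. -/
def horiz (v : LatticePath) (p : ℕ × ℕ) : ℤ := (rowEnd v p.2 : ℤ) - (p.1 : ℤ)

/-- For `u` with the same endpoints as `v`: the path `u` is weakly above `v`, that is, no point
of `u` is strictly to the right of `v`. (The points of `u` are the endpoints of its prefixes.) -/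
def WeaklyAbove (u v : LatticePath) : Prop :=
  ∀ w : LatticePath, w <+: u → 0 ≤ horiz v (endpoint w)

/-- The underlying set of `Tam v`: the paths weakly above `v` with the same endpoints. -/
def Tam (v : LatticePath) : Type :=
  {u : LatticePath // endpoint u = endpoint v ∧ WeaklyAbove u v}

/-- The covering relation `u <_v u'`. Here `u = a E d b`; the point `p`, the end of `a E`, is
followed by a north step (`d` starts with `N`); the point `p'`, the end of `a E d`, is the first
point of `u` after `p` at the same horizontal distance to `v` as `p`; and `u' = a d E b` is
obtained by switching `E` and `d`. -/
def Cover (v u u' : LatticePath) : Prop :=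
  ∃ a d b : LatticePath,
    u = a ++ [Step.E] ++ d ++ b ∧
    d.head? = some Step.N ∧
    horiz v (endpoint (a ++ [Step.E] ++ d)) = horiz v (endpoint (a ++ [Step.E])) ∧
    (∀ d' : LatticePath, d' <+: d → d' ≠ [] → d' ≠ d →
      horiz v (endpoint (a ++ [Step.E] ++ d')) ≠ horiz v (endpoint (a ++ [Step.E]))) ∧
    u' = a ++ d ++ [Step.E] ++ b

/-- Number of pairs (north step, later east step); used only for antisymmetry. -/
def area : LatticePath → ℕ
  | [] => 0
  | Step.E :: w => area w
  | Step.N :: w => w.count Step.E + area w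

theorem area_append (a b : LatticePath) :
    area (a ++ b) = area a + area b + a.count Step.N * b.count Step.E := by
  induction a with
  | nil => simp [area]
  | cons s a ih =>
    cases s
    · simp [area, ih]; ring
    · simp [area, ih]

theorem Cover.area_lt {v u u' : LatticePath} (h : Cover v u u') : area u < area u' := by
  obtain ⟨a, d, b, rfl, hd, -, -, rfl⟩ := h
  have hpos : 0 < d.count Step.N := by
    cases d with
    | nil => simp at hd
    | cons s d => simp at hd; subst hd; simp
  simp [area_append, area, List.count_append]
  nlinarith

/-- The poset `Tam v`: its order is the reflexive transitive closure of the covering relation. -/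
instance (v : LatticePath) : PartialOrder (Tam v) where
  le := Relation.ReflTransGen fun x y => Cover v x.1 y.1
  le_refl _ := Relation.ReflTransGen.refl
  le_trans _ _ _ := Relation.ReflTransGen.trans
  le_antisymm _ _ :=
    reflTransGen_antisymm (fun x : Tam v => area x.1) fun _ _ h => h.area_lt

/-- The path `(NE)^n`. -/
def staircase (n : ℕ) : LatticePath := (List.replicate n [Step.N, Step.E]).flatten

/-! ### Complete binary trees and the Tamari order

A term `T : BinaryTree Unit` represents a binary tree (`nil` is the empty tree) and, at the same
time, its completion, the complete binary tree whose interior vertices are the nodes of `T` and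
whose external vertices are the occurrences of `nil`. -/

/-- One right rotation. At the root `s = (t, C)`, with left child `t = (A, B)`, it makes `t` the
right child of `s`, with `A` the left subtree of `s` and `B`, `C` the subtrees of `t`; it may be
applied at any interior vertex. -/
inductive RightRotation : BinaryTree Unit → BinaryTree Unit → Prop
  | root (A B C : BinaryTree Unit) :
      RightRotation (.node () (.node () A B) C) (.node () A (.node () B C))
  | left {L L' : BinaryTree Unit} (R : BinaryTree Unit) (h : RightRotation L L') :
      RightRotation (.node () L R) (.node () L' R)
  | right (L : BinaryTree Unit) {R R' : BinaryTree Unit} (h : RightRotation R R') :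
      RightRotation (.node () L R) (.node () L R')

/-- Sum over the vertices of the size of the right subtree; used only for antisymmetry. -/
def rightWeight : BinaryTree Unit → ℕ
  | .nil => 0
  | .node _ L R => rightWeight L + rightWeight R + R.numNodes

theorem RightRotation.numNodes_eq {T T' : BinaryTree Unit} (h : RightRotation T T') :
    T.numNodes = T'.numNodes := by
  induction h with
  | root => simp; ring
  | left _ _ ih => simp [ih]
  | right _ _ ih => simp [ih]

theorem RightRotation.rightWeight_lt {T T' : BinaryTree Unit} (h : RightRotation T T') :
    rightWeight T < rightWeight T' := by
  induction h with
  | root => simp [rightWeight]; omega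
  | left _ _ ih => simp [rightWeight, ih]
  | right _ h ih => simp only [rightWeight, h.numNodes_eq]; omega

/-- The complete binary trees with `n` interior vertices. -/
def TamariTree (n : ℕ) : Type := {T : BinaryTree Unit // T.numNodes = n}

/-- The Tamari order on complete binary trees with `n` interior vertices: the reflexive
transitive closure of right rotation. -/
instance (n : ℕ) : PartialOrder (TamariTree n) where
  le := Relation.ReflTransGen fun S T => RightRotation S.1 T.1
  le_refl _ := Relation.ReflTransGen.refl
  le_trans _ _ _ := Relation.ReflTransGen.trans
  le_antisymm _ _ :=
    reflTransGen_antisymm (fun T : TamariTree n => rightWeight T.1) fun _ _ h => h.rightWeight_lt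

/-- The post-order traversal on the edges of the complete binary tree: walk around it from the
root, left subtrees first, and record a north step (resp. east step) each time a left (resp.
right) edge, internal or external, is traversed for the second time. -/
def postorderPath : BinaryTree Unit → LatticePath
  | .nil => []
  | .node _ L R => postorderPath L ++ [Step.N] ++ postorderPath R ++ [Step.E]

/-- The letters of the contour word: `a` and `aBar` (resp. `b` and `bBar`) stand for the first
and the second traversal of a left (resp. right) edge. -/
inductive Letter : Type
  | a : Letter
  | aBar : Letter
  | b : Letter
  | bBar : Letter

/-- The word obtained by walking around the binary tree `B` (not its completion) from the root,
left subtrees first. -/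
def contour : BinaryTree Unit → List Letter
  | .nil => []
  | .node _ L R =>
      (if L = .nil then [] else [Letter.a] ++ contour L ++ [Letter.aBar]) ++
      (if R = .nil then [] else [Letter.b] ++ contour R ++ [Letter.bBar])

/-- The contribution of a letter to the canopy: `aBar` gives a north step and `b` an east step. -/
def Letter.canopyStep : Letter → Option Step
  | .aBar => some Step.N
  | .b => some Step.E
  | .a => none
  | .bBar => none

/-- The canopy of the binary tree `B`, which is the interior canopy of its completion. -/
def canopy (B : BinaryTree Unit) : LatticePath := (contour B).filterMap Letter.canopyStep

/-- `I(v)`, among the complete binary trees with `n` interior vertices: those with interior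
canopy `v`. -/
def canopyClass (n : ℕ) (v : LatticePath) : Set (TamariTree n) := {T | canopy T.1 = v}

end NuTamari

open NuTamari

namespace NuTamari

open BinaryTree Relation

/-! ### Row ends and horizontal distances of concatenated paths -/

/-! A non-empty binary tree `T` is encoded by the pair (`interiorPath T`, `canopy T`). A left edge
writes `N` in both words at its second traversal. A right edge writes `E` in the canopy at its first
traversal, but in the interior path only at its second. The canopy therefore stays weakly to the
right. Cutting a non-crossing pair at the last contact of the upper path with the lower one, before
its endpoint, recovers the root decomposition. So trees with `n` nodes correspond bijectively to
non-crossing pairs of length `n - 1` (`interiorPath_canopy_injective`, `NonCrossing.exists_tree`).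

A rotation `((A,B),C)` to `(A,(B,C))` preserves the canopy exactly when `B` is non-empty, and
otherwise turns one of its `N` into `E`. The canopy-preserving rotations are exactly the covers of
`Tam v`, where `v` is the canopy (`rightRotation_iff_cover`): an `EN` in the interior path marks
such a rotation.

The number of `E` in the canopy never decreases under rotation, so a canopy class is convex and its
order is generated by rotations inside it; hence it is isomorphic to `Tam v`. Its minimal and
maximal elements are unique, because their interior paths are forced (the canopy itself,
respectively a word `N…NE…E`). This makes it an interval.

The usual Tamari lattice is an instance of the same correspondence: completing a tree changes its
interior path into the post-order path and its canopy into `(NE)^n`. -/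

theorem endpoint_append (a b : LatticePath) : endpoint (a ++ b) = endpoint a + endpoint b := by
  simp [endpoint]

@[simp] theorem endpoint_nil : endpoint [] = 0 := rfl

@[simp] theorem endpoint_snd (w : LatticePath) : (endpoint w).2 = w.count Step.N := rfl

@[simp] theorem endpoint_fst (w : LatticePath) : (endpoint w).1 = w.count Step.E := rfl

theorem length_eq_endpoint (w : LatticePath) : w.length = (endpoint w).1 + (endpoint w).2 := by
  induction w with
  | nil => rfl
  | cons s w ih => cases s <;> simp_all <;> omega

theorem length_eq_of_endpoint_eq {u v : LatticePath} (h : endpoint u = endpoint v) :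
    u.length = v.length := by
  rw [length_eq_endpoint, length_eq_endpoint, h]

theorem eq_nil_of_endpoint_eq_zero {w : LatticePath} (h : endpoint w = 0) : w = [] := by
  rw [← List.length_eq_zero_iff, length_eq_endpoint, h]; rfl

theorem endpoint_prefix_le {w u : LatticePath} (h : w <+: u) :
    w.count Step.N ≤ u.count Step.N ∧ w.count Step.E ≤ u.count Step.E :=
  ⟨h.sublist.count_le _, h.sublist.count_le _⟩

theorem rowEnd_append_add (v w : LatticePath) (y : ℕ) :
    rowEnd (v ++ w) (v.count Step.N + y) = v.count Step.E + rowEnd w y := by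
  induction v with
  | nil => simp
  | cons s v ih =>
    cases s
    · simp only [List.cons_append, List.count_cons_self]
      rw [show v.count Step.N + 1 + y = (v.count Step.N + y) + 1 by ring, rowEnd, ih]
      simp
    · simp [rowEnd, ih]; ring

theorem rowEnd_append_north (v w : LatticePath) {y : ℕ} (h : y ≤ v.count Step.N) :
    rowEnd (v ++ Step.N :: w) y = rowEnd v y := by
  induction v generalizing y with
  | nil => simp at h; subst h; simp [rowEnd]
  | cons s v ih =>
    cases s
    · cases y with
      | zero => simp [rowEnd]
      | succ y => simp at h; simp [rowEnd, ih h]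
    · simp at h; simp [rowEnd, ih h]

theorem rowEnd_le_append (v w : LatticePath) (y : ℕ) : rowEnd v y ≤ rowEnd (v ++ w) y := by
  induction v generalizing y with
  | nil => simp [rowEnd]
  | cons s v ih =>
    cases s
    · cases y with
      | zero => simp [rowEnd]
      | succ y => simp [rowEnd, ih]
    · simp [rowEnd, ih]

theorem rowEnd_le_count (v : LatticePath) (y : ℕ) : rowEnd v y ≤ v.count Step.E := by
  induction v generalizing y with
  | nil => simp [rowEnd]
  | cons s v ih =>
    cases s
    · cases y with
      | zero => simp [rowEnd]
      | succ y => simp [rowEnd, ih]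
    · simp [rowEnd, ih]

/-- Translation invariance: a common endpoint of two prefixes serves as a new origin. With
`horiz_append_north`, this reduces distances in a tree to distances in its subtrees. -/
theorem horiz_append {a v : LatticePath} (h : endpoint a = endpoint v) (w b : LatticePath) :
    horiz (v ++ w) (endpoint (a ++ b)) = horiz w (endpoint b) := by
  have h1 : (endpoint v).1 = v.count Step.E := rfl
  rw [endpoint_append, h, horiz, Prod.snd_add, endpoint_snd, endpoint_snd, rowEnd_append_add,
    horiz, Prod.fst_add]
  simp

/-- The north step closes the top row of `v`; without it, east steps at the start of `w` would
lengthen that row. -/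
theorem horiz_append_north (v w : LatticePath) {p : ℕ × ℕ} (h : p.2 ≤ v.count Step.N) :
    horiz (v ++ Step.N :: w) p = horiz v p := by
  rw [horiz, rowEnd_append_north v w h, horiz]

theorem horiz_cons_east (v : LatticePath) (p : ℕ × ℕ) :
    horiz (Step.E :: v) p = horiz v p + 1 := by
  simp [horiz, rowEnd]; ring

theorem horiz_cons_north (v w : LatticePath) :
    horiz (Step.N :: v) (endpoint (Step.N :: w)) = horiz v (endpoint w) := by
  simp [horiz, rowEnd]

theorem horiz_append_east (v w : LatticePath) :
    horiz v (endpoint (w ++ [Step.E])) = horiz v (endpoint w) - 1 := by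
  simp [horiz]; ring

theorem horiz_endpoint_eq {a v : LatticePath} (h : endpoint a = endpoint v) :
    horiz v (endpoint a) = 0 := by
  have := horiz_append h [] []
  simpa [horiz, rowEnd] using this

/-! ### Pairs of non-crossing paths -/

/-- The path `u` has the same endpoints as `v` and is weakly above `v`. -/
def NonCrossing (u v : LatticePath) : Prop := endpoint u = endpoint v ∧ WeaklyAbove u v

theorem prefix_append_cases {w a b : LatticePath} (h : w <+: a ++ b) :
    w <+: a ∨ ∃ c, w = a ++ c ∧ c <+: b := by
  obtain ⟨t, ht⟩ := h
  rcases List.append_eq_append_iff.1 ht with ⟨c, h1, h2⟩ | ⟨c, h1, h2⟩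
  · exact Or.inl ⟨c, h1.symm⟩
  · exact Or.inr ⟨c, h1, t, h2.symm⟩

theorem NonCrossing.refl (v : LatticePath) : NonCrossing v v := by
  refine ⟨rfl, fun w hw => ?_⟩
  obtain ⟨t, rfl⟩ := hw
  have := rowEnd_append_add w t 0
  rw [add_zero] at this
  simp [horiz, this]

theorem NonCrossing.append {u v u' v' : LatticePath} (h : NonCrossing u v)
    (h' : NonCrossing u' v') : NonCrossing (u ++ u') (v ++ v') := by
  refine ⟨by rw [endpoint_append, endpoint_append, h.1, h'.1], fun w hw => ?_⟩
  rcases prefix_append_cases hw with hw | ⟨c, rfl, hc⟩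
  · refine (h.2 w hw).trans ?_
    have := rowEnd_le_append v v' (endpoint w).2
    simp only [horiz]; omega
  · rw [horiz_append h.1]; exact h'.2 c hc

theorem NonCrossing.horiz_cons_east_pos {u v w : LatticePath} (h : NonCrossing u v)
    (hw : w <+: u) : 1 ≤ horiz (Step.E :: v) (endpoint w) := by
  have := h.2 w hw
  rw [horiz_cons_east]; omega

/-- The initial `E` moves `v` one unit to the right, so every point of `u` gains one unit of
distance, and the final `E` of the upper path uses it up. This is the effect of a right edge above a
subtree. -/
theorem NonCrossing.shift_east {u v : LatticePath} (h : NonCrossing u v) :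
    NonCrossing (u ++ [Step.E]) (Step.E :: v) := by
  have he : endpoint (u ++ [Step.E]) = endpoint (Step.E :: v) := by
    have := h.1
    simp only [endpoint, Prod.mk.injEq] at this
    simp [endpoint, this]
  refine ⟨he, fun w hw => ?_⟩
  rcases List.prefix_concat_iff.1 hw with rfl | hw
  · rw [horiz_endpoint_eq he]
  · have := h.horiz_cons_east_pos hw; omega

/-- If a point is at horizontal distance zero below the top row of `v`, then `v` goes through it
and continues with a north step. -/
theorem exists_eq_append_north {v : LatticePath} {p : ℕ × ℕ} (h : horiz v p = 0)
    (hp : p.2 < v.count Step.N) : ∃ v₁ v₂, v = v₁ ++ Step.N :: v₂ ∧ endpoint v₁ = p := by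
  induction v generalizing p with
  | nil => simp at hp
  | cons s v ih =>
    obtain ⟨x, y⟩ := p
    cases s
    · cases y with
      | zero => exact ⟨[], v, rfl, by simp [horiz, rowEnd] at h; simp [h]; rfl⟩
      | succ y =>
        obtain ⟨v₁, v₂, rfl, h2⟩ := ih (p := (x, y)) (by simpa [horiz, rowEnd] using h)
          (by simpa using hp)
        refine ⟨Step.N :: v₁, v₂, rfl, ?_⟩
        simp only [endpoint, Prod.mk.injEq] at h2 ⊢
        simp [h2]
    · cases x with
      | zero => simp [horiz, rowEnd] at h; omega
      | succ x =>
        obtain ⟨v₁, v₂, rfl, h2⟩ := ih (p := (x, y)) (by simpa [horiz, rowEnd] using h)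
          (by simpa using hp)
        refine ⟨Step.E :: v₁, v₂, rfl, ?_⟩
        simp only [endpoint, Prod.mk.injEq] at h2 ⊢
        simp [h2]

/-- Serves to cut a path at its last point at horizontal distance zero. -/
theorem exists_longest_prefix (P : LatticePath → Prop) (w : LatticePath) :
    (∀ p, p <+: w → ¬ P p) ∨
      ∃ p q, w = p ++ q ∧ P p ∧ ∀ q', q' <+: q → q' ≠ [] → ¬ P (p ++ q') := by
  induction w using List.reverseRecOn with
  | nil =>
    by_cases h : P []
    · exact Or.inr ⟨[], [], rfl, h, by simp⟩
    · exact Or.inl (by simpa using h)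
  | append_singleton w s ih =>
    by_cases h : P (w ++ [s])
    · exact Or.inr ⟨w ++ [s], [], by simp, h, by simp⟩
    · rcases ih with h1 | ⟨p, q, rfl, hp, hq⟩
      · refine Or.inl fun p hp => ?_
        rcases List.prefix_concat_iff.1 hp with rfl | hp
        · exact h
        · exact h1 p hp
      · refine Or.inr ⟨p, q ++ [s], by simp, hp, fun q' hq' hne => ?_⟩
        rcases List.prefix_concat_iff.1 hq' with rfl | hq'
        · simpa using h
        · exact hq q' hq' hne

/-! ### Covering relations at a given place -/

/-- `CoverAt v a u u'` says that `u'` covers `u` by switching the east step that follows the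
prefix `a` of `u`. -/
def CoverAt (v a u u' : LatticePath) : Prop :=
  ∃ d b : LatticePath,
    u = a ++ [Step.E] ++ d ++ b ∧
    d.head? = some Step.N ∧
    horiz v (endpoint (a ++ [Step.E] ++ d)) = horiz v (endpoint (a ++ [Step.E])) ∧
    (∀ d' : LatticePath, d' <+: d → d' ≠ [] → d' ≠ d →
      horiz v (endpoint (a ++ [Step.E] ++ d')) ≠ horiz v (endpoint (a ++ [Step.E]))) ∧
    u' = a ++ d ++ [Step.E] ++ b

theorem cover_iff_exists_coverAt {v u u' : LatticePath} :
    Cover v u u' ↔ ∃ a, CoverAt v a u u' := Iff.rfl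

/-- Two candidates for the switched part are prefixes of the same word, and the shorter would be an
earlier return for the longer. -/
theorem CoverAt.unique {v a u u₁ u₂ : LatticePath} (h₁ : CoverAt v a u u₁)
    (h₂ : CoverAt v a u u₂) : u₁ = u₂ := by
  obtain ⟨d₁, b₁, e₁, hd₁, hh₁, hf₁, rfl⟩ := h₁
  obtain ⟨d₂, b₂, e₂, hd₂, hh₂, hf₂, rfl⟩ := h₂
  have e : d₁ ++ b₁ = d₂ ++ b₂ := by
    have := e₁.symm.trans e₂
    simpa using this
  have hd : d₁ = d₂ := by
    by_contra hne
    have n₁ : d₁ ≠ [] := by rintro rfl; simp at hd₁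
    have n₂ : d₂ ≠ [] := by rintro rfl; simp at hd₂
    rcases List.prefix_or_prefix_of_prefix ⟨b₁, e⟩ (List.prefix_append d₂ b₂) with h | h
    · exact hf₂ d₁ h n₁ hne hh₁
    · exact hf₁ d₂ h n₂ (Ne.symm hne) hh₂
  subst hd
  simp_all

theorem CoverAt.append_north {v a u u' : LatticePath} (h : CoverAt v a u u')
    (he : endpoint u = endpoint v) (w c : LatticePath) :
    CoverAt (v ++ Step.N :: w) a (u ++ c) (u' ++ c) := by
  obtain ⟨d, b, rfl, hd, hh, hf, rfl⟩ := h
  have key : ∀ d', d' <+: d → horiz (v ++ Step.N :: w) (endpoint (a ++ [Step.E] ++ d')) =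
      horiz v (endpoint (a ++ [Step.E] ++ d')) := by
    intro d' hd'
    refine horiz_append_north v w ?_
    rw [← endpoint_snd v, ← he]
    refine (endpoint_prefix_le ?_).1
    rw [List.append_assoc _ d, List.prefix_append_right_inj]
    exact hd'.trans (List.prefix_append _ _)
  have key0 := key [] List.nil_prefix
  rw [List.append_nil] at key0
  refine ⟨d, b ++ c, by simp, hd, ?_, fun d' h1 h2 h3 => ?_, by simp⟩
  · rw [key d List.prefix_rfl, key0, hh]
  · rw [key d' h1, key0]; exact hf d' h1 h2 h3

theorem CoverAt.prepend {v a u u' a₀ v₀ : LatticePath} (h : CoverAt v a u u')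
    (he : endpoint a₀ = endpoint v₀) :
    CoverAt (v₀ ++ v) (a₀ ++ a) (a₀ ++ u) (a₀ ++ u') := by
  obtain ⟨d, b, rfl, hd, hh, hf, rfl⟩ := h
  have key (c : LatticePath) : horiz (v₀ ++ v) (endpoint (a₀ ++ a ++ c)) =
      horiz v (endpoint (a ++ c)) := by
    rw [List.append_assoc, horiz_append he]
  refine ⟨d, b, by simp, hd, ?_, fun d' h1 h2 h3 => ?_, by simp⟩
  · rw [List.append_assoc (a₀ ++ a), key, key, ← List.append_assoc, hh]
  · rw [List.append_assoc (a₀ ++ a), key, key, ← List.append_assoc]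
    exact hf d' h1 h2 h3

/-- All distances grow by one, and a cover depends only on equalities between distances. -/
theorem CoverAt.cons_east_append {v a u u' : LatticePath} (h : CoverAt v a u u')
    (c : LatticePath) : CoverAt (Step.E :: v) a (u ++ c) (u' ++ c) := by
  obtain ⟨d, b, rfl, hd, hh, hf, rfl⟩ := h
  refine ⟨d, b ++ c, by simp, hd, ?_, fun d' h1 h2 h3 => ?_, by simp⟩
  · rw [horiz_cons_east, horiz_cons_east, hh]
  · rw [horiz_cons_east, horiz_cons_east]
    have := hf d' h1 h2 h3
    omega

/-! ### The two paths of a binary tree -/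

/-- The post-order traversal of the interior edges: the path recording a north step (resp. an
east step) each time a left (resp. right) edge of the binary tree is traversed for the second
time. -/
def interiorPath : BinaryTree Unit → LatticePath
  | .nil => []
  | .node _ L R =>
      (if L = .nil then [] else interiorPath L ++ [Step.N]) ++
      (if R = .nil then [] else interiorPath R ++ [Step.E])

/-- The part of `interiorPath` that comes from the left subtree of the root. -/
def leftPath (L : BinaryTree Unit) : LatticePath :=
  if L = .nil then [] else interiorPath L ++ [Step.N]

/-- The part of `interiorPath` that comes from the right subtree of the root. -/
def rightPath (R : BinaryTree Unit) : LatticePath :=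
  if R = .nil then [] else interiorPath R ++ [Step.E]

/-- The part of the canopy that comes from the left subtree of the root. -/
def leftCanopy (L : BinaryTree Unit) : LatticePath :=
  if L = .nil then [] else canopy L ++ [Step.N]

/-- The part of the canopy that comes from the right subtree of the root. -/
def rightCanopy (R : BinaryTree Unit) : LatticePath :=
  if R = .nil then [] else Step.E :: canopy R

@[simp] theorem interiorPath_nil : interiorPath .nil = [] := rfl

@[simp] theorem canopy_nil : canopy .nil = [] := rfl

@[simp] theorem interiorPath_node (x : Unit) (L R : BinaryTree Unit) :
    interiorPath (.node x L R) = leftPath L ++ rightPath R := rfl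

@[simp] theorem canopy_node (x : Unit) (L R : BinaryTree Unit) :
    canopy (.node x L R) = leftCanopy L ++ rightCanopy R := by
  by_cases hL : L = .nil <;> by_cases hR : R = .nil <;>
    simp [canopy, contour, leftCanopy, rightCanopy, hL, hR, List.filterMap_cons,
      Letter.canopyStep]

@[simp] theorem leftPath_nil : leftPath .nil = [] := rfl
@[simp] theorem rightPath_nil : rightPath .nil = [] := rfl
@[simp] theorem leftCanopy_nil : leftCanopy .nil = [] := rfl
@[simp] theorem rightCanopy_nil : rightCanopy .nil = [] := rfl

theorem leftPath_of_ne {L : BinaryTree Unit} (h : L ≠ .nil) :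
    leftPath L = interiorPath L ++ [Step.N] := if_neg h
theorem rightPath_of_ne {R : BinaryTree Unit} (h : R ≠ .nil) :
    rightPath R = interiorPath R ++ [Step.E] := if_neg h
theorem leftCanopy_of_ne {L : BinaryTree Unit} (h : L ≠ .nil) :
    leftCanopy L = canopy L ++ [Step.N] := if_neg h
theorem rightCanopy_of_ne {R : BinaryTree Unit} (h : R ≠ .nil) :
    rightCanopy R = Step.E :: canopy R := if_neg h

@[simp] theorem leftPath_node (x : Unit) (L R : BinaryTree Unit) :
    leftPath (.node x L R) = interiorPath (.node x L R) ++ [Step.N] := leftPath_of_ne (by simp)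
@[simp] theorem rightPath_node (x : Unit) (L R : BinaryTree Unit) :
    rightPath (.node x L R) = interiorPath (.node x L R) ++ [Step.E] := rightPath_of_ne (by simp)
@[simp] theorem leftCanopy_node (x : Unit) (L R : BinaryTree Unit) :
    leftCanopy (.node x L R) = canopy (.node x L R) ++ [Step.N] := leftCanopy_of_ne (by simp)
@[simp] theorem rightCanopy_node (x : Unit) (L R : BinaryTree Unit) :
    rightCanopy (.node x L R) = Step.E :: canopy (.node x L R) := rightCanopy_of_ne (by simp)

theorem nonCrossing_interiorPath_canopy (T : BinaryTree Unit) :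
    NonCrossing (interiorPath T) (canopy T) := by
  induction T with
  | nil => exact .refl _
  | node x L R ihL ihR =>
    rw [interiorPath_node, canopy_node]
    refine .append ?_ ?_
    · by_cases hL : L = .nil
      · subst hL; exact .refl _
      · rw [leftPath_of_ne hL, leftCanopy_of_ne hL]; exact ihL.append (.refl _)
    · by_cases hR : R = .nil
      · subst hR; exact .refl _
      · rw [rightPath_of_ne hR, rightCanopy_of_ne hR]; exact ihR.shift_east

theorem nonCrossing_leftPath_leftCanopy (L : BinaryTree Unit) :
    NonCrossing (leftPath L) (leftCanopy L) := by
  simpa using nonCrossing_interiorPath_canopy (.node () L .nil)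

theorem nonCrossing_rightPath_rightCanopy (R : BinaryTree Unit) :
    NonCrossing (rightPath R) (rightCanopy R) := by
  simpa using nonCrossing_interiorPath_canopy (.node () .nil R)

theorem endpoint_interiorPath (T : BinaryTree Unit) :
    endpoint (interiorPath T) = endpoint (canopy T) := (nonCrossing_interiorPath_canopy T).1

/-- Each node of `L` accounts for the edge to its parent, the root of `L` included. -/
theorem length_leftPath (L : BinaryTree Unit) : (leftPath L).length = L.numNodes := by
  induction L with
  | nil => rfl
  | node x A B ihA ihB =>
    have : (rightPath B).length = B.numNodes := by
      cases B with
      | nil => rfl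
      | node y C D => simpa using ihB
    simp [ihA, this, add_assoc]

theorem length_rightPath (R : BinaryTree Unit) : (rightPath R).length = R.numNodes := by
  have := length_leftPath R
  cases R <;> simp_all

theorem length_interiorPath_add_one {T : BinaryTree Unit} (hT : T ≠ .nil) :
    (interiorPath T).length + 1 = T.numNodes := by
  rw [← length_leftPath, leftPath_of_ne hT]; simp

theorem length_canopy_add_one {T : BinaryTree Unit} (hT : T ≠ .nil) :
    (canopy T).length + 1 = T.numNodes := by
  rw [← length_interiorPath_add_one hT, length_eq_of_endpoint_eq (endpoint_interiorPath T)]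

/-! ### The two paths determine the tree -/

/-- Past the left part, the leading `E` of the right canopy keeps the path away from the canopy
until the endpoint. With `horiz_interiorPath_left`, the last contact before the endpoint occurs, for
non-empty `L` and `R`, after `L.numNodes - 1` steps, so the pair of words determines the size of
`L`. -/
theorem horiz_pos_of_length_le (L : BinaryTree Unit) {R : BinaryTree Unit} (hR : R ≠ .nil)
    {p : LatticePath} (hp : p <+: leftPath L ++ rightPath R)
    (hlen : L.numNodes ≤ p.length) (hne : p ≠ leftPath L ++ rightPath R) :
    1 ≤ horiz (leftCanopy L ++ rightCanopy R) (endpoint p) := by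
  obtain ⟨c, rfl, hc⟩ : ∃ c, p = leftPath L ++ c ∧ c <+: rightPath R := by
    rcases prefix_append_cases hp with h | h
    · have : p = leftPath L := h.eq_of_length (by
        have := h.length_le; rw [length_leftPath] at this ⊢; omega)
      exact ⟨[], by simp [this], List.nil_prefix⟩
    · exact h
  rw [horiz_append (nonCrossing_leftPath_leftCanopy L).1, rightCanopy_of_ne hR]
  refine (nonCrossing_interiorPath_canopy R).horiz_cons_east_pos ?_
  rw [rightPath_of_ne hR, List.prefix_concat_iff] at hc
  rcases hc with rfl | hc
  · simp [rightPath_of_ne hR] at hne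
  · exact hc

theorem horiz_interiorPath_left {L : BinaryTree Unit} (hL : L ≠ .nil) (R : BinaryTree Unit) :
    horiz (leftCanopy L ++ rightCanopy R) (endpoint (interiorPath L)) = 0 := by
  rw [leftCanopy_of_ne hL, List.append_assoc, List.singleton_append,
    horiz_append_north _ _ (by rw [endpoint_interiorPath]; rfl),
    horiz_endpoint_eq (endpoint_interiorPath L)]

theorem numNodes_left_le {L R L' R' : BinaryTree Unit} (hR : R ≠ .nil)
    (hU : leftPath L ++ rightPath R = leftPath L' ++ rightPath R')
    (hV : leftCanopy L ++ rightCanopy R = leftCanopy L' ++ rightCanopy R') :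
    L'.numNodes ≤ L.numNodes := by
  by_contra! hlt
  have hL' : L' ≠ .nil := by rintro rfl; simp at hlt
  have h0 := horiz_interiorPath_left hL' R'
  have hlen := length_interiorPath_add_one hL'
  rw [← hV] at h0
  have h1 := horiz_pos_of_length_le L hR (p := interiorPath L')
    (by rw [hU, leftPath_of_ne hL', List.append_assoc]; exact List.prefix_append _ _)
    (by omega)
    (by rw [hU, leftPath_of_ne hL']; simp)
  omega

/-- The empty tree is excluded because it has the same two empty words as the one-node tree. The
last letter of the interior path tells whether the right subtree is empty; if it is not, the last
contact gives the size of the left subtree. Both words can then be cut and the induction applies. -/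
theorem interiorPath_canopy_injective {T T' : BinaryTree Unit} (hT : T ≠ .nil) (hT' : T' ≠ .nil)
    (hU : interiorPath T = interiorPath T') (hV : canopy T = canopy T') : T = T' := by
  induction T generalizing T' with
  | nil => exact absurd rfl hT
  | node x L R ihL ihR =>
    cases T' with
    | nil => exact absurd rfl hT'
    | node x' L' R' =>
      simp only [interiorPath_node, canopy_node] at hU hV
      have hlen := congrArg List.length hU
      simp only [List.length_append, length_leftPath, length_rightPath] at hlen
      have hRR : R = .nil ↔ R' = .nil := by
        have key : ∀ {L R L' R' : BinaryTree Unit},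
            leftPath L ++ rightPath R = leftPath L' ++ rightPath R' → R = .nil →
            R' = .nil := by
          intro L R L' R' h hR
          subst hR
          by_contra hR'
          rw [rightPath_of_ne hR', rightPath_nil, List.append_nil, ← List.append_assoc] at h
          by_cases hL : L = .nil
          · subst hL; simp at h
          · rw [leftPath_of_ne hL] at h
            have := List.append_inj_right' h rfl
            simp at this
        exact ⟨key hU, key hU.symm⟩
      have hLL : L.numNodes = L'.numNodes := by
        by_cases hR : R = .nil
        · rw [hRR.1 hR, hR] at hlen; simpa using hlen
        · exact le_antisymm (numNodes_left_le (fun h => hR (hRR.2 h)) hU.symm hV.symm)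
            (numNodes_left_le hR hU hV)
      obtain ⟨hU1, hU2⟩ := List.append_inj hU (by rw [length_leftPath, length_leftPath, hLL])
      obtain ⟨hV1, hV2⟩ := List.append_inj hV (by
        rw [← length_eq_of_endpoint_eq (nonCrossing_leftPath_leftCanopy L).1,
          ← length_eq_of_endpoint_eq (nonCrossing_leftPath_leftCanopy L').1, hU1])
      have hL : L = L' := by
        by_cases h : L = .nil
        · subst h
          cases L' with
          | nil => rfl
          | node _ _ _ => simp at hLL
        · have h' : L' ≠ .nil := by
            rintro rfl
            cases L with
            | nil => exact h rfl
            | node _ _ _ => simp at hLL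
          rw [leftPath_of_ne h, leftPath_of_ne h'] at hU1
          rw [leftCanopy_of_ne h, leftCanopy_of_ne h'] at hV1
          exact ihL h h' (List.append_cancel_right hU1) (List.append_cancel_right hV1)
      have hR : R = R' := by
        by_cases h : R = .nil
        · rw [h, hRR.1 h]
        · have h' : R' ≠ .nil := fun h' => h (hRR.2 h')
          rw [rightPath_of_ne h, rightPath_of_ne h'] at hU2
          rw [rightCanopy_of_ne h, rightCanopy_of_ne h'] at hV2
          exact ihR h h' (List.append_cancel_right hU2) (List.cons_injective hV2)
      rw [hL, hR]

/-! ### Every non-crossing pair comes from a tree -/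

/-- Before a final north step the abscissa is already the maximal one of `v`, which leaves no room
to the right. -/
theorem NonCrossing.horiz_eq_zero_of_append_north {u v : LatticePath}
    (h : NonCrossing (u ++ [Step.N]) v) : horiz v (endpoint u) = 0 := by
  have h0 := h.2 u (List.prefix_append _ _)
  have h1 := rowEnd_le_count v (endpoint u).2
  have h2 : (endpoint u).1 = v.count Step.E := by
    rw [← endpoint_fst v, ← h.1]; simp
  simp only [horiz] at h0 ⊢
  omega

theorem NonCrossing.of_append_north {u w v₁ v₂ : LatticePath}
    (h : NonCrossing (u ++ Step.N :: w) (v₁ ++ Step.N :: v₂))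
    (he : endpoint v₁ = endpoint u) : NonCrossing u v₁ := by
  refine ⟨he.symm, fun p hp => ?_⟩
  rw [← horiz_append_north v₁ v₂]
  · exact h.2 p (hp.trans (List.prefix_append _ _))
  · rw [← endpoint_snd v₁, he]; exact (endpoint_prefix_le hp).1

theorem NonCrossing.of_shift_east {u v : LatticePath} (h : NonCrossing (u ++ [Step.E]) v)
    (hpos : ∀ p, p <+: u → 1 ≤ horiz v (endpoint p)) :
    ∃ v', v = Step.E :: v' ∧ NonCrossing u v' := by
  have h0 := hpos [] List.nil_prefix
  obtain ⟨he, -⟩ := h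
  cases v with
  | nil => simp [horiz, rowEnd] at h0
  | cons s v =>
    cases s
    · simp [horiz, rowEnd] at h0
    · refine ⟨v, rfl, ?_, fun p hp => ?_⟩
      · simp only [endpoint, Prod.mk.injEq] at he ⊢
        simpa using he
      · have := hpos p hp
        rw [horiz_cons_east] at this
        omega

theorem NonCrossing.of_append {u w v₁ v₂ : LatticePath}
    (h : NonCrossing (u ++ w) (v₁ ++ v₂)) (he : endpoint u = endpoint v₁) :
    NonCrossing w v₂ := by
  refine ⟨?_, fun p hp => ?_⟩
  · have := h.1
    rw [endpoint_append, endpoint_append, he] at this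
    exact add_left_cancel this
  · rw [← horiz_append he]
    exact h.2 _ (by rwa [List.prefix_append_right_inj])

/-- Induction on length. A final `N` means that the root has no right child. Before a final `E`, the
last contact separates the left subtree from the right one; if there is no contact, the root has no
left child. -/
theorem NonCrossing.exists_tree {u v : LatticePath} (h : NonCrossing u v) :
    ∃ T : BinaryTree Unit, T ≠ .nil ∧ interiorPath T = u ∧ canopy T = v := by
  induction hk : u.length using Nat.strong_induction_on generalizing u v with
  | _ k ih =>
  subst hk
  rcases List.eq_nil_or_concat u with rfl | ⟨u, s, rfl⟩
  · refine ⟨.node () .nil .nil, by simp, by simp, ?_⟩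
    rw [eq_nil_of_endpoint_eq_zero h.1.symm]; simp
  · rw [List.concat_eq_append] at *
    cases s
    · have h0 := h.horiz_eq_zero_of_append_north
      obtain ⟨v₁, v₂, rfl, he⟩ := exists_eq_append_north h0 (by
        rw [← endpoint_snd v, ← h.1]; simp)
      have hlen := length_eq_of_endpoint_eq h.1
      have hlen' := length_eq_of_endpoint_eq he
      obtain rfl : v₂ = [] := by
        rw [← List.length_eq_zero_iff]
        simp at hlen; omega
      obtain ⟨T, hT, rfl, rfl⟩ := ih u.length (by simp) (h.of_append_north he) rfl
      exact ⟨.node () T .nil, by simp, by simp [leftPath_of_ne hT],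
        by simp [leftCanopy_of_ne hT]⟩
    · have hnn : ∀ p, p <+: u → 0 ≤ horiz v (endpoint p) := fun p hp =>
        h.2 p (hp.trans (List.prefix_append _ _))
      rcases exists_longest_prefix (fun p => horiz v (endpoint p) = 0) u with
        hpos | ⟨p, q, rfl, hp, hq⟩
      · obtain ⟨v', rfl, h'⟩ := h.of_shift_east fun p hp => by
          have := hnn p hp; have := hpos p hp; omega
        obtain ⟨T, hT, rfl, rfl⟩ := ih u.length (by simp) h' rfl
        exact ⟨.node () .nil T, by simp, by simp [rightPath_of_ne hT],
          by simp [rightCanopy_of_ne hT]⟩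
      -- From a contact point an east step would lead to distance `-1`, so the step after `p` is
      -- `N`, and `v` also continues with `N` there.
      · have hnext : ∀ r, ¬ p ++ [Step.E] ++ r = p ++ q ++ [Step.E] := fun r hr => by
          have := h.2 (p ++ [Step.E]) ⟨r, hr⟩
          rw [horiz_append_east] at this
          omega
        cases q with
        | nil => exact absurd (by simp) (hnext [])
        | cons s q =>
          cases s
          · obtain ⟨v₁, v₂, rfl, he⟩ := exists_eq_append_north hp (by
              rw [← endpoint_snd v, ← h.1]; simp [List.count_append])
            have h₁ : NonCrossing p v₁ := NonCrossing.of_append_north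
              (w := q ++ [Step.E]) (by simpa using h) he
            have he' : endpoint (p ++ [Step.N]) = endpoint (v₁ ++ [Step.N]) := by
              rw [endpoint_append, endpoint_append, he]
            have h₂ : NonCrossing (q ++ [Step.E]) v₂ :=
              NonCrossing.of_append (u := p ++ [Step.N]) (v₁ := v₁ ++ [Step.N])
                (by simpa using h) he'
            obtain ⟨v₃, rfl, h₃⟩ := h₂.of_shift_east fun r hr => by
              have h1 := hnn (p ++ Step.N :: r) (by
                rw [List.prefix_append_right_inj, List.cons_prefix_cons]; exact ⟨rfl, hr⟩)
              have h2 := hq (Step.N :: r) (by rw [List.cons_prefix_cons]; exact ⟨rfl, hr⟩)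
                (by simp)
              rw [horiz_append he.symm, horiz_cons_north] at h1 h2
              omega
            obtain ⟨A, hA, rfl, rfl⟩ := ih p.length (by simp) h₁ rfl
            obtain ⟨B, hB, rfl, rfl⟩ := ih q.length (by simp; omega) h₃ rfl
            exact ⟨.node () A B, by simp, by simp [leftPath_of_ne hA, rightPath_of_ne hB],
              by simp [leftCanopy_of_ne hA, rightCanopy_of_ne hB]⟩
          · exact absurd (by simp) (hnext (q ++ [Step.E]))

/-! ### Right rotations and covering relations -/

theorem RightRotation.left_ne_nil {S T : BinaryTree Unit} (h : RightRotation S T) :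
    S ≠ .nil := by
  cases h <;> simp

theorem RightRotation.right_ne_nil {S T : BinaryTree Unit} (h : RightRotation S T) :
    T ≠ .nil := by
  cases h <;> simp

/-- At the root, a non-empty `B` contributes `E`, its canopy and `N` both before and after the
rotation, the two letters coming from different edges. For empty `B` a single `N` becomes `E`. -/
theorem RightRotation.canopy_eq_or_lt {S T : BinaryTree Unit} (h : RightRotation S T) :
    canopy T = canopy S ∨ (canopy S).count Step.E < (canopy T).count Step.E := by
  induction h with
  | root A B C =>
    by_cases hB : B = .nil
    · right; simp [hB]
    · left; simp [rightCanopy_of_ne hB, leftCanopy_of_ne hB]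
  | left R h ih =>
    simp only [canopy_node, leftCanopy_of_ne h.left_ne_nil, leftCanopy_of_ne h.right_ne_nil]
    rcases ih with ih | ih
    · left; rw [ih]
    · right; simpa using ih
  | right L h ih =>
    simp only [canopy_node, rightCanopy_of_ne h.left_ne_nil, rightCanopy_of_ne h.right_ne_nil]
    rcases ih with ih | ih
    · left; rw [ih]
    · right; simpa using ih

/-- The rotation moves the `E` closing `B` to the end of the word, past `N` and the path of `C`.
That `E` ends at a contact point, and by positivity on the right part the next contact is the
endpoint. -/
theorem coverAt_root (A : BinaryTree Unit) {B : BinaryTree Unit} (hB : B ≠ .nil)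
    (C : BinaryTree Unit) :
    CoverAt (canopy (.node () (.node () A B) C)) (leftPath A ++ interiorPath B)
      (interiorPath (.node () (.node () A B) C)) (interiorPath (.node () A (.node () B C))) := by
  have hv : canopy (.node () (.node () A B) C) =
      (leftCanopy A ++ rightCanopy B) ++ (Step.N :: rightCanopy C) := by simp
  have he : endpoint (leftPath A ++ rightPath B) = endpoint (leftCanopy A ++ rightCanopy B) := by
    simpa using endpoint_interiorPath (.node () A B)
  have ha : leftPath A ++ interiorPath B ++ [Step.E] = leftPath A ++ rightPath B := by
    simp [rightPath_of_ne hB]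
  have h0 : horiz (Step.N :: rightCanopy C) (endpoint []) = 0 := by simp [horiz, rowEnd]
  refine ⟨Step.N :: rightPath C, [], ?_, rfl, ?_, fun d' h1 h2 h3 => ?_, ?_⟩
  · simp [rightPath_of_ne hB]
  · rw [hv, ha, horiz_append he, ← List.append_nil (leftPath A ++ rightPath B), horiz_append he,
      h0, horiz_cons_north, horiz_endpoint_eq (nonCrossing_rightPath_rightCanopy C).1]
  · rw [hv, ha, horiz_append he, ← List.append_nil (leftPath A ++ rightPath B), horiz_append he,
      h0]
    rcases List.prefix_cons_iff.1 h1 with rfl | ⟨t, rfl, ht⟩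
    · exact absurd rfl h2
    rw [horiz_cons_north]
    by_cases hC : C = .nil
    · subst hC
      simp at ht
      subst ht
      simp at h3
    · rw [rightPath_of_ne hC, List.prefix_concat_iff] at ht
      rcases ht with rfl | ht
      · simp [rightPath_of_ne hC] at h3
      · have := (nonCrossing_interiorPath_canopy C).horiz_cons_east_pos ht
        rw [rightCanopy_of_ne hC]
        omega
  · simp [leftPath_of_ne hB]

theorem CoverAt.node_left {L L' : BinaryTree Unit} (hL : L ≠ .nil) (hL' : L' ≠ .nil)
    {a : LatticePath} (h : CoverAt (canopy L) a (interiorPath L) (interiorPath L'))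
    (R : BinaryTree Unit) :
    CoverAt (canopy (.node () L R)) a (interiorPath (.node () L R))
      (interiorPath (.node () L' R)) := by
  simpa [leftPath_of_ne hL, leftPath_of_ne hL', leftCanopy_of_ne hL] using
    h.append_north (endpoint_interiorPath L) (rightCanopy R) (Step.N :: rightPath R)

theorem CoverAt.node_right {R R' : BinaryTree Unit} (hR : R ≠ .nil) (hR' : R' ≠ .nil)
    {a : LatticePath} (h : CoverAt (canopy R) a (interiorPath R) (interiorPath R'))
    (L : BinaryTree Unit) :
    CoverAt (canopy (.node () L R)) (leftPath L ++ a) (interiorPath (.node () L R))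
      (interiorPath (.node () L R')) := by
  simpa [rightPath_of_ne hR, rightPath_of_ne hR', rightCanopy_of_ne hR] using
    (h.cons_east_append [Step.E]).prepend (nonCrossing_leftPath_leftCanopy L).1

theorem RightRotation.cover {S T : BinaryTree Unit} (h : RightRotation S T)
    (hc : canopy S = canopy T) : Cover (canopy S) (interiorPath S) (interiorPath T) := by
  rw [cover_iff_exists_coverAt]
  induction h with
  | root A B C =>
    by_cases hB : B = .nil
    · simp [hB] at hc
    · exact ⟨_, coverAt_root A hB C⟩
  | left R h ih =>
    obtain ⟨a, ha⟩ := ih (by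
      simpa [leftCanopy_of_ne h.left_ne_nil, leftCanopy_of_ne h.right_ne_nil] using hc)
    exact ⟨a, ha.node_left h.left_ne_nil h.right_ne_nil R⟩
  | right L h ih =>
    obtain ⟨a, ha⟩ := ih (by
      simpa [rightCanopy_of_ne h.left_ne_nil, rightCanopy_of_ne h.right_ne_nil] using hc)
    exact ⟨_, ha.node_right h.left_ne_nil h.right_ne_nil L⟩

/-- Reading `E` then `N` means returning from a non-empty right subtree to a vertex that is itself a
left child, so its parent can be rotated with a non-empty middle subtree. -/
theorem exists_rotation_of_east_north {T : BinaryTree Unit} {a b : LatticePath}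
    (h : interiorPath T = a ++ Step.E :: Step.N :: b) :
    ∃ T', RightRotation T T' ∧ canopy T' = canopy T ∧
      CoverAt (canopy T) a (interiorPath T) (interiorPath T') := by
  induction T generalizing a b with
  | nil => simp at h
  | node x L R ihL ihR =>
    have inRight : ∀ a', a = leftPath L ++ a' → rightPath R = a' ++ Step.E :: Step.N :: b →
        ∃ T', RightRotation (.node x L R) T' ∧ canopy T' = canopy (.node x L R) ∧
          CoverAt (canopy (.node x L R)) a (interiorPath (.node x L R)) (interiorPath T') := by
      rintro a' rfl h2
      have hR : R ≠ .nil := by rintro rfl; simp at h2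
      rw [rightPath_of_ne hR] at h2
      -- The right part ends with `E`, so the `N` is not its last letter and the factor `EN` lies
      -- inside `interiorPath R`.
      rcases List.eq_nil_or_concat b with rfl | ⟨b, s, rfl⟩
      · have := congrArg List.getLast? h2
        simp at this
      · have h3 : interiorPath R = a' ++ Step.E :: Step.N :: b := by
          have : interiorPath R ++ [Step.E] = (a' ++ Step.E :: Step.N :: b) ++ [s] := by simp [h2]
          exact List.append_inj_left' this rfl
        obtain ⟨R', hrot, hc, hcov⟩ := ihR h3
        exact ⟨.node () L R', hrot.right L,
          by simp [rightCanopy_of_ne hR, rightCanopy_of_ne hrot.right_ne_nil, hc],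
          hcov.node_right hR hrot.right_ne_nil L⟩
    by_cases hL : L = .nil
    · subst hL
      exact inRight a rfl (by simpa using h)
    have h' : interiorPath L ++ Step.N :: rightPath R = a ++ Step.E :: Step.N :: b := by
      simpa [leftPath_of_ne hL] using h
    have inLeft : ∀ b', interiorPath L = a ++ Step.E :: Step.N :: b' →
        ∃ T', RightRotation (.node x L R) T' ∧ canopy T' = canopy (.node x L R) ∧
          CoverAt (canopy (.node x L R)) a (interiorPath (.node x L R)) (interiorPath T') := by
      intro b' h3
      obtain ⟨L', hrot, hc, hcov⟩ := ihL h3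
      exact ⟨.node () L' R, hrot.left R,
        by simp [leftCanopy_of_ne hL, leftCanopy_of_ne hrot.right_ne_nil, hc],
        hcov.node_left hL hrot.right_ne_nil R⟩
    rcases List.append_eq_append_iff.1 h' with ⟨c, h1, h2⟩ | ⟨c, h1, h2⟩
    · cases c with
      | nil => simp at h2
      | cons s c =>
        simp only [List.cons_append, List.cons.injEq] at h2
        obtain ⟨rfl, h2⟩ := h2
        exact inRight c (by simp [h1, leftPath_of_ne hL]) h2
    · rcases c with _ | ⟨s, _ | ⟨s', c⟩⟩
      · simp at h2
      · simp only [List.cons_append, List.nil_append, List.cons.injEq] at h2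
        obtain ⟨rfl, -, -⟩ := h2
        -- Here the `E` is the last letter of `interiorPath L` and the `N` comes from the left edge
        -- of the root: the rotation is at the root.
        cases L with
        | nil => exact absurd rfl hL
        | node y A B =>
          have hB : B ≠ .nil := by
            rintro rfl
            have := congrArg List.getLast? h1
            by_cases hA : A = .nil
            · simp [hA] at this
            · simp [leftPath_of_ne hA] at this
          have ha : a = leftPath A ++ interiorPath B := by
            rw [interiorPath_node, rightPath_of_ne hB, ← List.append_assoc] at h1
            exact (List.append_inj_left' h1 rfl).symm
          subst ha
          exact ⟨.node () A (.node () B R), .root A B R,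
            by simp [leftCanopy_of_ne hB, rightCanopy_of_ne hB], coverAt_root A hB R⟩
      · simp only [List.cons_append, List.cons.injEq] at h2
        obtain ⟨rfl, rfl, -⟩ := h2
        exact inLeft c h1

/-- For the converse, the switched part starts with `N`, so a cover exhibits an `EN`. The rotation
there gives a cover at the same place, hence the same path, and injectivity identifies the trees. -/
theorem rightRotation_iff_cover {S T : BinaryTree Unit} (hT : T ≠ .nil)
    (hc : canopy S = canopy T) :
    RightRotation S T ↔ Cover (canopy S) (interiorPath S) (interiorPath T) := by
  refine ⟨fun h => h.cover hc, ?_⟩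
  rintro ⟨a, h : CoverAt _ a _ _⟩
  have h' := h
  obtain ⟨d, b, hu, hd, -⟩ := h'
  obtain ⟨d, rfl⟩ : ∃ d', d = Step.N :: d' := by
    cases d with
    | nil => simp at hd
    | cons s d => simp at hd; exact ⟨d, by rw [hd]⟩
  obtain ⟨T', hrot, hc', hcov⟩ := exists_rotation_of_east_north (T := S) (a := a) (b := d ++ b)
    (by simpa using hu)
  rwa [interiorPath_canopy_injective hT hrot.right_ne_nil (h.unique hcov) (by rw [hc', hc])]

/-! ### Extremal trees with a given canopy -/

theorem eq_replicate_of_no_east_north {w : LatticePath}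
    (h : ∀ a b, w ≠ a ++ Step.E :: Step.N :: b) :
    w = List.replicate (w.count Step.N) Step.N ++ List.replicate (w.count Step.E) Step.E := by
  induction w with
  | nil => rfl
  | cons s w ih =>
    have ih' := ih fun a b hw => h (s :: a) b (by simp [hw])
    cases s
    · simp only [List.count_cons_self, List.replicate_succ, List.cons_append, List.cons.injEq,
        true_and]
      simpa using ih'
    · have h0 : w.count Step.N = 0 := by
        by_contra h0
        obtain ⟨k, hk⟩ := Nat.exists_eq_succ_of_ne_zero h0
        rw [hk, List.replicate_succ, List.cons_append] at ih'
        exact h [] _ (congrArg (Step.E :: ·) ih')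
      rw [h0] at ih'
      simp only [List.replicate_zero, List.nil_append] at ih'
      simp [h0, List.replicate_succ, ← ih']

/-- Without a canopy-preserving rotation the interior path has no factor `EN`, so its endpoint
determines it, and the canopy determines that endpoint. -/
theorem eq_of_no_rotation {S T : BinaryTree Unit} (hS : S ≠ .nil) (hT : T ≠ .nil)
    (hc : canopy S = canopy T) (hS' : ∀ X, RightRotation S X → canopy X ≠ canopy S)
    (hT' : ∀ X, RightRotation T X → canopy X ≠ canopy T) : S = T := by
  have key : ∀ X : BinaryTree Unit, (∀ Y, RightRotation X Y → canopy Y ≠ canopy X) →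
      interiorPath X = List.replicate ((canopy X).count Step.N) Step.N ++
        List.replicate ((canopy X).count Step.E) Step.E := by
    intro X hX
    have he := endpoint_interiorPath X
    simp only [endpoint, Prod.mk.injEq] at he
    rw [← he.1, ← he.2]
    refine eq_replicate_of_no_east_north fun a b h => ?_
    obtain ⟨Y, hrot, hY, -⟩ := exists_rotation_of_east_north h
    exact hX Y hrot hY
  exact interiorPath_canopy_injective hS hT (by rw [key S hS', key T hT', hc]) hc

/-- No canopy-preserving rotation ends at the root, so a right child has no left child. The second
conjunct, which strengthens the induction, then makes the path of the right subtree a power of `E`,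
for which a leading and a trailing `E` agree. -/
theorem interiorPath_eq_canopy_of_no_rotation {T : BinaryTree Unit}
    (h : ∀ X, RightRotation X T → canopy X ≠ canopy T) :
    interiorPath T = canopy T ∧
      (T.left = .nil → interiorPath T = List.replicate (interiorPath T).length Step.E) := by
  induction T with
  | nil => simp
  | node x L R ihL ihR =>
    have hl : leftPath L = leftCanopy L := by
      by_cases hL : L = .nil
      · rw [hL]; rfl
      · rw [leftPath_of_ne hL, leftCanopy_of_ne hL, (ihL fun X hX hXc => h _ (hX.left R) (by
          simp [leftCanopy_of_ne hL, leftCanopy_of_ne hX.left_ne_nil, hXc])).1]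
    have hr : rightPath R = rightCanopy R ∧
        rightPath R = List.replicate (rightPath R).length Step.E := by
      by_cases hR : R = .nil
      · rw [hR]; exact ⟨rfl, rfl⟩
      · obtain ⟨h1, h2⟩ := ihR fun X hX hXc => h _ (hX.right L) (by
          simp [rightCanopy_of_ne hR, rightCanopy_of_ne hX.left_ne_nil, hXc])
        have h3 : R.left = .nil := by
          cases R with
          | nil => rfl
          | node y B C =>
            by_contra hB'
            have hB : B ≠ .nil := hB'
            exact h _ (.root L B C) (by
              simp [leftCanopy_of_ne hB, rightCanopy_of_ne hB])
        replace h2 := h2 h3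
        rw [rightPath_of_ne hR, rightCanopy_of_ne hR, ← h1]
        generalize (interiorPath R).length = k at h2
        rw [h2]
        refine ⟨?_, ?_⟩
        · rw [← List.replicate_succ, ← List.replicate_succ']
        · simp [← List.replicate_succ']
    refine ⟨by rw [interiorPath_node, canopy_node, hl, hr.1], fun hLnil => ?_⟩
    obtain rfl : L = .nil := hLnil
    simpa using hr.2

theorem eq_of_no_rotation_into {S T : BinaryTree Unit} (hS : S ≠ .nil) (hT : T ≠ .nil)
    (hc : canopy S = canopy T) (hS' : ∀ X, RightRotation X S → canopy X ≠ canopy S)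
    (hT' : ∀ X, RightRotation X T → canopy X ≠ canopy T) : S = T :=
  interiorPath_canopy_injective hS hT
    (by rw [(interiorPath_eq_canopy_of_no_rotation hS').1,
      (interiorPath_eq_canopy_of_no_rotation hT').1, hc]) hc

/-! ### The trees with a given canopy form an interval -/

theorem reflTransGen_iff_of_equiv {α β : Type*} {r : α → α → Prop} {s : β → β → Prop}
    (e : α ≃ β) (h : ∀ a b, r a b ↔ s (e a) (e b)) (a b : α) :
    ReflTransGen s (e a) (e b) ↔ ReflTransGen r a b := by
  refine ⟨fun hs => ?_, ReflTransGen.lift e (fun a b => (h a b).1) a b⟩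
  have := ReflTransGen.lift (p := r) e.symm (fun x y hxy => (h _ _).2 (by simpa using hxy)) _ _ hs
  simpa [Function.onFun] using this

theorem TamariTree.ne_nil {n : ℕ} (hn : 1 ≤ n) (T : TamariTree n) : T.1 ≠ .nil := fun h => by
  have := T.2
  rw [h] at this
  simp at this
  omega

theorem TamariTree.canopy_eq_or_lt {n : ℕ} {S T : TamariTree n} (h : S ≤ T) :
    canopy T.1 = canopy S.1 ∨ (canopy S.1).count Step.E < (canopy T.1).count Step.E := by
  change ReflTransGen (fun S T : TamariTree n => RightRotation S.1 T.1) S T at h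
  induction h with
  | refl => exact Or.inl rfl
  | tail _ hr ih =>
    rcases hr.canopy_eq_or_lt with h1 | h1 <;> rcases ih with h2 | h2
    · exact Or.inl (h1.trans h2)
    · right; rwa [h1]
    · right; rwa [← h2]
    · exact Or.inr (h2.trans h1)

/-- Convexity: a change of canopy strictly raises the number of `E`, which can never drop back. -/
theorem TamariTree.canopy_eq_of_le_of_le {n : ℕ} {S X T : TamariTree n} (h₁ : S ≤ X)
    (h₂ : X ≤ T) (hc : canopy S.1 = canopy T.1) : canopy X.1 = canopy S.1 := by
  rcases canopy_eq_or_lt h₁ with h | h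
  · exact h
  · rcases canopy_eq_or_lt h₂ with h' | h'
    · rw [hc, h']
    · rw [hc] at h; omega

theorem TamariTree.le_of_rotation {n : ℕ} {S T : TamariTree n} (h : RightRotation S.1 T.1) :
    S ≤ T := ReflTransGen.single h

instance (n : ℕ) : Finite (TamariTree n) :=
  Set.Finite.to_subtype (s := {T : BinaryTree Unit | T.numNodes = n}) <| by
    refine (treesOfNumNodesEq n).finite_toSet.subset fun T hT => ?_
    simpa [mem_treesOfNumNodesEq] using hT

/-- By convexity, a chain of rotations between two members of the class never leaves it. -/
theorem le_iff_reflTransGen_canopyClass {n : ℕ} {v : LatticePath} (S T : canopyClass n v) :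
    S ≤ T ↔ ReflTransGen (fun X Y : canopyClass n v => RightRotation X.1.1 Y.1.1) S T := by
  constructor
  · intro h
    obtain ⟨T, hT⟩ := T
    change ReflTransGen (fun S T : TamariTree n => RightRotation S.1 T.1) S.1 T at h
    induction h with
    | refl => exact .refl
    | tail hSX hr ih =>
      rename_i X Y
      have hX : canopy X.1 = v := by
        have h1 : canopy S.1.1 = v := S.2
        rw [← TamariTree.canopy_eq_of_le_of_le hSX (TamariTree.le_of_rotation hr)
          (h1.trans hT.symm)] at h1
        exact h1
      exact (ih hX).tail hr
  · exact ReflTransGen.lift (p := fun S T : TamariTree n => RightRotation S.1 T.1)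
      Subtype.val (fun _ _ h => h) S T

theorem exists_canopyClass_eq_Icc {n : ℕ} (hn : 1 ≤ n) {v : LatticePath}
    (hne : (canopyClass n v).Nonempty) :
    ∃ S T : TamariTree n, S ≤ T ∧ canopyClass n v = Set.Icc S T := by
  have hfin : (canopyClass n v).Finite := Set.toFinite _
  have rot_of_max : ∀ {T}, Maximal (· ∈ canopyClass n v) T →
      ∀ X, RightRotation T.1 X → canopy X ≠ canopy T.1 := by
    intro T hT X hX hc
    have hle : T ≤ ⟨X, hX.numNodes_eq.symm.trans T.2⟩ := TamariTree.le_of_rotation hX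
    have h := le_antisymm hle (hT.2 (hc.trans hT.1) hle)
    have hw := hX.rightWeight_lt
    rw [h] at hw
    exact lt_irrefl _ hw
  have rot_of_min : ∀ {T}, Minimal (· ∈ canopyClass n v) T →
      ∀ X, RightRotation X T.1 → canopy X ≠ canopy T.1 := by
    intro T hT X hX hc
    have hle : ⟨X, hX.numNodes_eq.trans T.2⟩ ≤ T := TamariTree.le_of_rotation hX
    have h := le_antisymm hle (hT.2 (hc.trans hT.1) hle)
    have hw := hX.rightWeight_lt
    rw [← h] at hw
    exact lt_irrefl _ hw
  obtain ⟨S, hS⟩ := hfin.exists_minimal hne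
  obtain ⟨T, hT⟩ := hfin.exists_maximal hne
  have hSle : ∀ X ∈ canopyClass n v, S ≤ X := by
    intro X hX
    obtain ⟨S', hle, hS'⟩ := hfin.exists_le_minimal hX
    have : S = S' := Subtype.ext <| eq_of_no_rotation_into (S.ne_nil hn) (S'.ne_nil hn)
      (hS.1.trans hS'.1.symm) (rot_of_min hS) (rot_of_min hS')
    rwa [this]
  have hleT : ∀ X ∈ canopyClass n v, X ≤ T := by
    intro X hX
    obtain ⟨T', hle, hT'⟩ := hfin.exists_le_maximal hX
    have : T = T' := Subtype.ext <| eq_of_no_rotation (T.ne_nil hn) (T'.ne_nil hn)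
      (hT.1.trans hT'.1.symm) (rot_of_max hT) (rot_of_max hT')
    rwa [this]
  refine ⟨S, T, hSle T hT.1, Set.Subset.antisymm (fun X hX => ⟨hSle X hX, hleT X hX⟩) ?_⟩
  rintro X ⟨h1, h2⟩
  exact (TamariTree.canopy_eq_of_le_of_le h1 h2 (hS.1.trans hT.1.symm)).trans hS.1

/-! ### The trees with canopy `v` are ordered as `Tam v` -/

theorem exists_orderIso_canopyClass_tam {n : ℕ} (hn : 1 ≤ n) {v : LatticePath}
    (hv : v.length + 1 = n) :
    ∃ e : canopyClass n v ≃o Tam v, ∀ T, (e T).1 = interiorPath T.1.1 := by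
  have hnc : ∀ T : canopyClass n v, NonCrossing (interiorPath T.1.1) v := fun T => by
    have h := nonCrossing_interiorPath_canopy T.1.1
    rwa [show canopy T.1.1 = v from T.2] at h
  let f : canopyClass n v → Tam v := fun T => ⟨interiorPath T.1.1, hnc T⟩
  have hf : Function.Bijective f := by
    refine ⟨fun S T h => ?_, fun u => ?_⟩
    · exact Subtype.ext <| Subtype.ext <| interiorPath_canopy_injective (S.1.ne_nil hn)
        (T.1.ne_nil hn) (congrArg Subtype.val h) (S.2.trans T.2.symm)
    · obtain ⟨T, hT, h1, h2⟩ := NonCrossing.exists_tree u.2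
      refine ⟨⟨⟨T, ?_⟩, h2⟩, Subtype.ext h1⟩
      rw [← length_canopy_add_one hT, h2, hv]
  refine ⟨⟨Equiv.ofBijective f hf, fun {S T} => ?_⟩, fun T => rfl⟩
  rw [le_iff_reflTransGen_canopyClass]
  refine reflTransGen_iff_of_equiv (s := fun x y : Tam v => Cover v x.1 y.1)
    (Equiv.ofBijective f hf) (fun X Y => ?_) S T
  have h := rightRotation_iff_cover (S := X.1.1) (Y.1.ne_nil hn) (X.2.trans Y.2.symm)
  rwa [show canopy X.1.1 = v from X.2] at h

/-! ### Complete binary trees as binary trees -/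

/-- The completion of a binary tree, with its external vertices turned into nodes. -/
def complete : BinaryTree Unit → BinaryTree Unit
  | .nil => .node () .nil .nil
  | .node _ L R => .node () (complete L) (complete R)

theorem complete_ne_nil (T : BinaryTree Unit) : complete T ≠ .nil := by
  cases T <;> simp [complete]

theorem numNodes_complete (T : BinaryTree Unit) : (complete T).numNodes = 2 * T.numNodes + 1 := by
  induction T with
  | nil => rfl
  | node x L R ihL ihR => simp [complete, ihL, ihR]; ring

theorem interiorPath_complete (T : BinaryTree Unit) :
    interiorPath (complete T) = postorderPath T := by
  induction T with
  | nil => rfl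
  | node x L R ihL ihR =>
    simp [complete, postorderPath, leftPath_of_ne (complete_ne_nil L),
      rightPath_of_ne (complete_ne_nil R), ihL, ihR]

theorem staircase_add (m n : ℕ) : staircase (m + n) = staircase m ++ staircase n := by
  rw [staircase, List.replicate_add, List.flatten_append, staircase, staircase]

theorem staircase_succ (n : ℕ) : staircase (n + 1) = Step.N :: Step.E :: staircase n := by
  simp [staircase, List.replicate_succ]

/-- In a completion every node of `T` has two children, so its left edge writes `N` immediately
before its right edge writes `E`. -/
theorem canopy_complete (T : BinaryTree Unit) : canopy (complete T) = staircase T.numNodes := by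
  induction T with
  | nil => rfl
  | node x L R ihL ihR =>
    rw [complete, canopy_node, leftCanopy_of_ne (complete_ne_nil L),
      rightCanopy_of_ne (complete_ne_nil R), ihL, ihR, numNodes,
      show L.numNodes + R.numNodes + 1 = L.numNodes + (R.numNodes + 1) by ring, staircase_add,
      staircase_succ]
    simp

theorem length_staircase (n : ℕ) : (staircase n).length = 2 * n := by
  induction n with
  | zero => rfl
  | succ n ih => rw [staircase_succ]; simp [ih]; ring

theorem eq_staircase_of_append_eq {n : ℕ} {v w : LatticePath}
    (h : v ++ Step.N :: w = staircase n) :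
    ∃ i j, v = staircase i ∧ w = Step.E :: staircase j ∧ n = i + j + 1 := by
  induction n generalizing v with
  | zero => simp [staircase] at h
  | succ n ih =>
    rw [staircase_succ] at h
    rcases v with _ | ⟨s, _ | ⟨s', v⟩⟩
    · simp at h
      exact ⟨0, n, rfl, h, by omega⟩
    · simp at h
    · simp only [List.cons_append, List.cons.injEq] at h
      obtain ⟨rfl, rfl, h⟩ := h
      obtain ⟨i, j, rfl, rfl, rfl⟩ := ih h
      exact ⟨i + 1, j, (staircase_succ i).symm, rfl, by omega⟩

theorem getLast?_staircase_ne_north (n : ℕ) : (staircase n).getLast? ≠ some Step.N := by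
  cases n with
  | zero => simp [staircase]
  | succ n => rw [staircase_add n 1]; simp [staircase]

/-- A root with only a right child would give a canopy starting with `E`, and one with only a left
child a canopy ending with `N`. With two children, the canopy splits into two staircases around
`NE`. -/
theorem exists_eq_complete {F : BinaryTree Unit} {n : ℕ} (hF : F ≠ .nil)
    (hc : canopy F = staircase n) : ∃ T, F = complete T := by
  induction F generalizing n with
  | nil => exact absurd rfl hF
  | node x L R ihL ihR =>
    rw [canopy_node] at hc
    by_cases hL : L = .nil
    · subst hL
      by_cases hR : R = .nil
      · subst hR; exact ⟨.nil, rfl⟩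
      · rw [rightCanopy_of_ne hR] at hc
        cases n with
        | zero => simp [staircase] at hc
        | succ n => rw [staircase_succ] at hc; simp at hc
    · rw [leftCanopy_of_ne hL] at hc
      by_cases hR : R = .nil
      · subst hR
        have := congrArg List.getLast? hc
        simp at this
        exact absurd this.symm (getLast?_staircase_ne_north n)
      · rw [rightCanopy_of_ne hR, List.append_assoc, List.singleton_append] at hc
        obtain ⟨i, j, h1, h2, -⟩ := eq_staircase_of_append_eq hc
        obtain ⟨A, rfl⟩ := ihL hL h1
        obtain ⟨B, rfl⟩ := ihR hR (List.cons_injective h2)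
        exact ⟨.node () A B, rfl⟩

theorem complete_injective : Function.Injective complete := by
  intro S T h
  induction S generalizing T with
  | nil =>
    cases T with
    | nil => rfl
    | node y A B => simp [complete, (complete_ne_nil A).symm] at h
  | node x L R ihL ihR =>
    cases T with
    | nil => simp [complete, complete_ne_nil] at h
    | node y A B =>
      simp only [complete, node.injEq, true_and] at h
      rw [ihL h.1, ihR h.2]

theorem RightRotation.complete {S T : BinaryTree Unit} (h : RightRotation S T) :
    RightRotation (complete S) (complete T) := by
  induction h with
  | root A B C => exact .root _ _ _
  | left R h ih => exact .left _ ih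
  | right L h ih => exact .right _ ih

/-- A rotation cannot involve an added leaf as the left child: its empty subtrees would have to be
subtrees of a completion's interior vertex, or `C` would be empty. So the pieces of a root rotation
are themselves completions. -/
theorem rightRotation_of_complete {S T : BinaryTree Unit}
    (h : RightRotation (complete S) (complete T)) : RightRotation S T := by
  induction S generalizing T with
  | nil =>
    cases T with
    | nil => exact absurd h.rightWeight_lt (lt_irrefl _)
    | node y A B =>
      have := h.numNodes_eq
      simp [numNodes_complete] at this
  | node x L R ihL ihR =>
    cases T with
    | nil =>
      have := h.numNodes_eq
      simp [numNodes_complete] at this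
    | node y L' R' =>
      simp only [NuTamari.complete] at h
      generalize hl : NuTamari.complete L = l at h
      generalize hr : NuTamari.complete R = r at h
      generalize hl' : NuTamari.complete L' = l' at h
      generalize hr' : NuTamari.complete R' = r' at h
      cases h with
      | root A B C =>
        cases L with
        | nil =>
          cases R' with
          | nil =>
            simp only [NuTamari.complete, node.injEq, true_and] at hr'
            exact absurd (hr.trans hr'.2.symm) (complete_ne_nil R)
          | node z B' C' =>
            simp only [NuTamari.complete, node.injEq, true_and] at hl hr'
            exact absurd (hr'.1.trans hl.2.symm) (complete_ne_nil B')
        | node w A' B' =>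
          cases R' with
          | nil =>
            simp only [NuTamari.complete, node.injEq, true_and] at hr'
            exact absurd (hr.trans hr'.2.symm) (complete_ne_nil R)
          | node z B₂ C₂ =>
            simp only [NuTamari.complete, node.injEq, true_and] at hl hr'
            obtain rfl := complete_injective (hl.1.trans hl'.symm)
            obtain rfl := complete_injective (hl.2.trans hr'.1.symm)
            obtain rfl := complete_injective (hr.trans hr'.2.symm)
            exact .root _ _ _
      | left _ h =>
        obtain rfl := complete_injective (hr.trans hr'.symm)
        subst hl hl'
        exact .left _ (ihL h)
      | right _ h =>
        obtain rfl := complete_injective (hl.trans hl'.symm)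
        subst hr hr'
        exact .right _ (ihR h)

theorem exists_orderIso_tamariTree_tam (n : ℕ) :
    ∃ φ : TamariTree n ≃o Tam (staircase n), ∀ T, (φ T).1 = postorderPath T.1 := by
  have hcan : ∀ T : TamariTree n, canopy (complete T.1) = staircase n := fun T => by
    rw [canopy_complete, T.2]
  have hnc : ∀ T : TamariTree n, NonCrossing (postorderPath T.1) (staircase n) := fun T => by
    rw [← hcan T, ← interiorPath_complete]; exact nonCrossing_interiorPath_canopy _
  let f : TamariTree n → Tam (staircase n) := fun T => ⟨postorderPath T.1, hnc T⟩
  have hf : Function.Bijective f := by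
    refine ⟨fun S T h => ?_, fun u => ?_⟩
    · have h' : postorderPath S.1 = postorderPath T.1 := congrArg Subtype.val h
      rw [← interiorPath_complete, ← interiorPath_complete] at h'
      exact Subtype.ext <| complete_injective <| interiorPath_canopy_injective
        (complete_ne_nil _) (complete_ne_nil _) h' ((hcan S).trans (hcan T).symm)
    · obtain ⟨F, hF, h1, h2⟩ := NonCrossing.exists_tree u.2
      obtain ⟨T, rfl⟩ := exists_eq_complete hF h2
      refine ⟨⟨T, ?_⟩, Subtype.ext ?_⟩
      · have := congrArg List.length h2
        rw [canopy_complete, length_staircase, length_staircase] at this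
        omega
      · change postorderPath T = u.1
        rw [← h1, interiorPath_complete]
  refine ⟨⟨Equiv.ofBijective f hf, fun {S T} => ?_⟩, fun T => rfl⟩
  refine reflTransGen_iff_of_equiv (r := fun S T : TamariTree n => RightRotation S.1 T.1)
    (s := fun x y : Tam (staircase n) => Cover (staircase n) x.1 y.1)
    (Equiv.ofBijective f hf) (fun X Y => ?_) S T
  have h := rightRotation_iff_cover (S := complete X.1) (complete_ne_nil Y.1)
    ((hcan X).trans (hcan Y).symm)
  rw [hcan, interiorPath_complete, interiorPath_complete] at h
  exact ⟨fun hr => h.1 hr.complete, fun hc => rightRotation_of_complete (h.2 hc)⟩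

end NuTamari

/-! ### The decomposition of the usual Tamari lattice into canopy classes -/

theorem theorem3 (n : ℕ) (hn : 1 ≤ n) :
    ∃ φ : TamariTree n ≃o Tam (staircase n),
      (∀ T : TamariTree n, (φ T).1 = postorderPath T.1) ∧
      (⋃ v ∈ {v : LatticePath | v.length + 1 = n}, φ '' canopyClass n v) = Set.univ ∧
      {v : LatticePath | v.length + 1 = n}.PairwiseDisjoint (fun v => φ '' canopyClass n v) ∧
      ∀ v : LatticePath, v.length + 1 = n →
        (∃ S T : TamariTree n, S ≤ T ∧
          canopyClass n v = Set.Icc S T ∧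
          φ '' canopyClass n v = Set.Icc (φ S) (φ T)) ∧
        Nonempty (canopyClass n v ≃o Tam v) := by
  obtain ⟨φ, hφ⟩ := exists_orderIso_tamariTree_tam n
  refine ⟨φ, hφ, ?_, ?_, fun v hv => ?_⟩
  · refine Set.eq_univ_of_forall fun u => ?_
    have hlen := length_canopy_add_one ((φ.symm u).ne_nil hn)
    rw [(φ.symm u).2] at hlen
    exact Set.mem_biUnion (x := canopy (φ.symm u).1) hlen ⟨φ.symm u, rfl, φ.apply_symm_apply u⟩
  · intro v _ w _ hvw
    refine (Set.disjoint_image_iff φ.injective).2 (Set.disjoint_left.2 fun T hv hw => ?_)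
    exact hvw (Eq.trans (Eq.symm hv) hw)
  · obtain ⟨e, -⟩ := exists_orderIso_canopyClass_tam hn hv
    have hne : (canopyClass n v).Nonempty := by
      -- The class is non-empty because the pair formed by `v` and itself is non-crossing.
      obtain ⟨T, hT, -, h⟩ := NonCrossing.exists_tree (NonCrossing.refl v)
      exact ⟨⟨T, by rw [← length_canopy_add_one hT, h, hv]⟩, h⟩
    obtain ⟨S, T, hle, hIcc⟩ := exists_canopyClass_eq_Icc hn hne
    exact ⟨⟨S, T, hle, hIcc, by rw [hIcc, OrderIso.image_Icc]⟩, ⟨e⟩⟩
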